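/- Let $G$ be a connected (real, finite-dimensional, smooth) Lie group with Lie algebra $\mathfrak{g}=T_1G$, and let $\rho: G\to GL(V)$ be a smooth representation of $G$ in a finite-dimensional real vector space $V$, with differential $d\rho:\mathfrak{g}\to\mathfrak{gl}(V)$. Suppose that $\ker(\rho)$ is discrete in $G$. Let $f\in\mathbb{R}[\lambda]$ be a nonzero real polynomial without multiple roots in $\mathbb{C}$. Then: (i) Every connected component of the subset $Z(\rho,f)=\{g\in G \mid f(\rho(g))=0\}$ of $G$ is a closed embedded submanifold of $G$, and is a conjugacy class in $G$. (ii) Every connected component of the subset $\mathfrak{z}(d\rho,f)=\{X\in\mathfrak{g} \mid f(d\rho(X))=0\}$ of $\mathfrak{g}$ is a closed embedded submanifold of $\mathfrak{g}$, and is an adjoint orbit in $\mathfrak{g}$, that is, a set of the form $\{\mathrm{Ad}(h)X\mid h\in G\}$ with $X\in\mathfrak{g}$. -/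

import Mathlib

open scoped Manifold ContDiff

/-- A subset `S` of a smooth manifold `M` modelled on the finite-dimensional real vector space `E`
is an embedded (regular) submanifold if, for some dimension `k`, each of its points lies in the
domain of a chart `φ` of the smooth structure of `M` in which `S` is a `k`-dimensional slice:
inside the domain of `φ`, the set `S` is the preimage of an affine subspace of dimension `k`. -/
def IsEmbeddedSubmanifold (E : Type*) [NormedAddCommGroup E] [NormedSpace ℝ E]
    {M : Type*} [TopologicalSpace M] [ChartedSpace E M] (S : Set M) : Prop :=
  ∃ k : ℕ, ∀ p ∈ S, ∃ φ ∈ IsManifold.maximalAtlas 𝓘(ℝ, E) ∞ M, p ∈ φ.source ∧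
    ∃ F : Submodule ℝ E, Module.finrank ℝ F = k ∧
      ∀ x ∈ φ.source, x ∈ S ↔ φ x - φ p ∈ F

/-- A closed embedded submanifold: an embedded submanifold that is a closed subset. -/
def IsClosedEmbeddedSubmanifold (E : Type*) [NormedAddCommGroup E] [NormedSpace ℝ E]
    {M : Type*} [TopologicalSpace M] [ChartedSpace E M] (S : Set M) : Prop :=
  IsClosed S ∧ IsEmbeddedSubmanifold E S

section LieGroupNotions

variable {E : Type*} [NormedAddCommGroup E] [NormedSpace ℝ E]
  {G : Type*} [TopologicalSpace G] [ChartedSpace E G] [Group G]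

/-- The Lie algebra of a Lie group, as a smooth manifold: the vector space `T₁G`, whose underlying
type is the model space `E`, with the identity as its global chart. -/
instance groupLieAlgebraChartedSpace : ChartedSpace E (GroupLieAlgebra 𝓘(ℝ, E) G) :=
  inferInstanceAs (ChartedSpace E E)

/-- The smooth structure given by the global identity chart is indeed a smooth structure. -/
instance groupLieAlgebraIsManifold : IsManifold 𝓘(ℝ, E) ∞ (GroupLieAlgebra 𝓘(ℝ, E) G) :=
  inferInstanceAs (IsManifold 𝓘(ℝ, E) ∞ E)

/-- The adjoint representation: `Ad h` is the differential at `1` of `x ↦ h * x * h⁻¹`. -/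
noncomputable def lieAd (h : G) :
    GroupLieAlgebra 𝓘(ℝ, E) G →L[ℝ] GroupLieAlgebra 𝓘(ℝ, E) G :=
  mfderiv 𝓘(ℝ, E) 𝓘(ℝ, E) (fun x : G => h * x * h⁻¹) 1

/-- The adjoint orbit `{Ad h X | h ∈ G}` of an element `X` of the Lie algebra of `G`. -/
def adjointOrbit (X : GroupLieAlgebra 𝓘(ℝ, E) G) : Set (GroupLieAlgebra 𝓘(ℝ, E) G) :=
  Set.range fun h : G => lieAd h X

variable {V : Type*} [NormedAddCommGroup V] [NormedSpace ℝ V]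

/-- The differential `dρ : 𝔤 → End V` at `1` of a representation `ρ : G → GL(V) ⊆ End V`. -/
noncomputable def representationDifferential (ρ : G →* (V →L[ℝ] V)ˣ) :
    GroupLieAlgebra 𝓘(ℝ, E) G →L[ℝ] (V →L[ℝ] V) :=
  mfderiv 𝓘(ℝ, E) 𝓘(ℝ, V →L[ℝ] V) (fun g : G => (ρ g : V →L[ℝ] V)) 1

/-- The subset `{g | f (ρ g) = 0}` of `G`. -/
def groupZeroSet (ρ : G →* (V →L[ℝ] V)ˣ) (f : Polynomial ℝ) : Set G :=
  {g | Polynomial.aeval (ρ g : V →L[ℝ] V) f = 0}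

/-- The subset `{X | f (dρ X) = 0}` of the Lie algebra of `G`. -/
def lieAlgebraZeroSet (ρ : G →* (V →L[ℝ] V)ˣ) (f : Polynomial ℝ) :
    Set (GroupLieAlgebra 𝓘(ℝ, E) G) :=
  {X | Polynomial.aeval (representationDifferential ρ X) f = 0}

end LieGroupNotions

/-! Both statements concern a connected group acting smoothly (by conjugation on `G`, by `Ad` on the
Lie algebra) and the zero set `Z` of a smooth map `F` with `Z` invariant. If at each point of `Z`
the kernel of the differential of `F` equals the tangent space of the orbit, then each orbit in `Z`
is locally a slice and relatively open in `Z`. Orbits partition `Z`, so they are also closed; being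
connected, they are the components (`exists_slice_chart`, `connectedComponentIn_zeroSet_eq_orbit`).

The infinitesimal condition is a dimension count. Let `D` be the differential of the orbit map at a
zero with image `A` in `End V`, and `L` that of `F`. Then `L ∘ D = 0`, and `ker D` consists of
vectors `y` with `dρ y` commuting with `A`. In commuting directions the differential of `f` is
multiplication by `f'(A)`, a unit because `f` is separable and `f(A) = 0`; and `dρ` is injective
because `ker ρ` is discrete. So `ker D` embeds into the range of `L`, and rank-nullity forces `ker L
= range D` (`LinearMap.ker_eq_range_of_injOn_ker`). -/

open Filter Topology Set

/-! ### Charts from local parametrizations. -/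

section Charts

variable {E : Type*} [NormedAddCommGroup E] [NormedSpace ℝ E]
  {M : Type*} [TopologicalSpace M] [ChartedSpace E M]

/-- Through each point of a manifold passes a local parametrization whose differential is the
identity of the model space. -/
theorem exists_local_parametrization [IsManifold 𝓘(ℝ, E) ∞ M] (x : M) :
    ∃ s : E → M, s 0 = x ∧ (∀ᶠ w in 𝓝 (0 : E), ContMDiffAt 𝓘(ℝ, E) 𝓘(ℝ, E) ∞ s w) ∧
      HasMFDerivAt 𝓘(ℝ, E) 𝓘(ℝ, E) s 0 (ContinuousLinearMap.id ℝ E) := by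
  set e := chartAt E x with he
  have hx : x ∈ e.source := mem_chart_source E x
  have hcont : Continuous fun w : E => e x + w := by fun_prop
  have hU : ∀ᶠ w in 𝓝 (0 : E), e x + w ∈ e.target :=
    hcont.continuousAt.preimage_mem_nhds (by
      simpa using e.open_target.mem_nhds (e.map_source hx))
  have hs0 : e.symm (e x + 0) = x := by rw [add_zero, e.left_inv hx]
  have hsm : ∀ w, e x + w ∈ e.target →
      ContMDiffAt 𝓘(ℝ, E) 𝓘(ℝ, E) ∞ (fun w => e.symm (e x + w)) w := by
    intro w hw
    have h1 : ContMDiffAt 𝓘(ℝ, E) 𝓘(ℝ, E) ∞ e.symm (e x + w) :=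
      contMDiffAt_symm_of_mem_maximalAtlas (IsManifold.chart_mem_maximalAtlas x) hw
    have h2 : ContMDiffAt 𝓘(ℝ, E) 𝓘(ℝ, E) ∞ (fun w : E => e x + w) w :=
      (contDiff_const.add contDiff_id).contMDiff.contMDiffAt
    exact h1.comp w h2
  refine ⟨fun w => e.symm (e x + w), hs0, hU.mono hsm, (hsm 0 hU.self_of_nhds).continuousAt, ?_⟩
  simp only [writtenInExtChartAt, hs0, mfld_simps]
  refine HasFDerivAt.hasFDerivWithinAt ?_
  refine ((hasFDerivAt_id (0 : E)).const_add (e x)).congr_of_eventuallyEq ?_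
  filter_upwards [hU] with w hw
  exact e.right_inv hw

/-- The inverse function theorem on a manifold: a smooth parametrization with injective
differential at `a` restricts to the inverse of a chart. -/
theorem exists_chart_of_injective_mfderiv [FiniteDimensional ℝ E] [IsManifold 𝓘(ℝ, E) ∞ M]
    {Ψ : E → M} {a : E} {U : Set E} (hU : U ∈ 𝓝 a)
    (hΨ : ∀ w ∈ U, ContMDiffAt 𝓘(ℝ, E) 𝓘(ℝ, E) ∞ Ψ w)
    (hinj : Function.Injective (mfderiv 𝓘(ℝ, E) 𝓘(ℝ, E) Ψ a)) :
    ∃ φ ∈ IsManifold.maximalAtlas 𝓘(ℝ, E) ∞ M, a ∈ φ.target ∧ φ.target ⊆ U ∧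
      ∀ w ∈ φ.target, φ.symm w = Ψ w := by
  have : CompleteSpace E := FiniteDimensional.complete ℝ E
  set e := chartAt E (Ψ a) with he
  have hea : Ψ a ∈ e.source := mem_chart_source E _
  have haU : a ∈ U := mem_of_mem_nhds hU
  obtain ⟨U', hU'U, hU'o, haU'⟩ : ∃ U' ⊆ U ∩ Ψ ⁻¹' e.source, IsOpen U' ∧ a ∈ U' :=
    mem_nhds_iff.1 (inter_mem hU
      ((hΨ a haU).continuousAt.preimage_mem_nhds (e.open_source.mem_nhds hea)))
  set f : E → E := fun w => e (Ψ w) with hf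
  have hfs : ∀ w ∈ U', ContDiffAt ℝ ∞ f w := fun w hw =>
    contMDiffAt_iff_contDiffAt.1 ((contMDiffAt_of_mem_maximalAtlas
      (IsManifold.chart_mem_maximalAtlas (Ψ a)) (hU'U hw).2).comp w (hΨ w (hU'U hw).1))
  have hfd : ∀ w ∈ U', HasFDerivAt f (fderiv ℝ f w) w := fun w hw =>
    ((hfs w hw).differentiableAt (by simp)).hasFDerivAt
  have hmf : mfderiv 𝓘(ℝ, E) 𝓘(ℝ, E) Ψ a = fderiv ℝ f a := by
    rw [((hΨ a haU).mdifferentiableAt (by simp)).mfderiv]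
    simp only [writtenInExtChartAt, mfld_simps, fderivWithin_univ]
    rfl
  have hinj' : Function.Injective (fderiv ℝ f a) := by rw [← hmf]; exact hinj
  let L : E ≃L[ℝ] E := (LinearEquiv.ofInjectiveEndo
    (fderiv ℝ f a : E →ₗ[ℝ] E) hinj').toContinuousLinearEquiv
  have hL : (L : E →L[ℝ] E) = fderiv ℝ f a := by ext; rfl
  have hcd : ContinuousAt (fderiv ℝ f) a :=
    ((hfs a haU').fderiv_right (m := 0) (by simp)).continuousAt
  -- Invertibility of the differential is open, so after shrinking to `O` the local inverse is
  -- smooth on its whole domain, not only at the image of `a`.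
  obtain ⟨O, hOsub, hOo, haO⟩ : ∃ O ⊆ {w | ∃ L' : E ≃L[ℝ] E, (L' : E →L[ℝ] E) = fderiv ℝ f w},
      IsOpen O ∧ a ∈ O := by
    have hmem := ContinuousLinearEquiv.nhds L
    rw [hL] at hmem
    exact mem_nhds_iff.1 (hcd.preimage_mem_nhds hmem)
  have hfa : HasFDerivAt f (L : E →L[ℝ] E) a := hL ▸ hfd a haU'
  let T := ((hfs a haU').toOpenPartialHomeomorph f hfa (by simp)).restr (U' ∩ O)
  have hTs : T.source ⊆ U' ∩ O := by
    intro w hw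
    have := hw.2
    rwa [(hU'o.inter hOo).interior_eq] at this
  have haT : a ∈ T.source := by
    refine ⟨ContDiffAt.mem_toOpenPartialHomeomorph_source _ _ _, ?_⟩
    rw [(hU'o.inter hOo).interior_eq]
    exact ⟨haU', haO⟩
  have hTf : ∀ w, T w = f w := fun w => rfl
  have hsymm : ∀ y ∈ T.target, ContMDiffAt 𝓘(ℝ, E) 𝓘(ℝ, E) ∞ T.symm y := by
    intro y hy
    have hw := hTs (T.map_target hy)
    obtain ⟨L', hL'⟩ := hOsub hw.2
    exact (T.contDiffAt_symm hy (hL' ▸ hfd _ hw.1) (hfs _ hw.1)).contMDiffAt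
  refine ⟨e.trans T.symm, ?_, ?_, ?_, ?_⟩
  · apply OpenPartialHomeomorph.mem_maximalAtlas_of_contMDiffOn
    · intro x hx
      rw [OpenPartialHomeomorph.trans_source] at hx
      exact ((hsymm _ hx.2).comp x (contMDiffAt_of_mem_maximalAtlas
        (IsManifold.chart_mem_maximalAtlas (Ψ a)) hx.1)).contMDiffWithinAt
    · intro w hw
      rw [OpenPartialHomeomorph.trans_target] at hw
      have hwT : w ∈ T.source := hw.1
      exact ((contMDiffAt_symm_of_mem_maximalAtlas
        (IsManifold.chart_mem_maximalAtlas (Ψ a)) hw.2).comp w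
        (hfs w (hTs hwT).1).contMDiffAt).contMDiffWithinAt
  · rw [OpenPartialHomeomorph.trans_target]
    exact ⟨haT, e.map_source hea⟩
  · intro w hw
    rw [OpenPartialHomeomorph.trans_target] at hw
    exact (hU'U (hTs hw.1).1).1
  · intro w hw
    rw [OpenPartialHomeomorph.trans_target] at hw
    exact e.left_inv (hU'U (hTs hw.1).1).2

end Charts
-- Polynomial calculus in a Banach algebra.
section Poly
open Polynomial

variable {A : Type*} [NormedRing A] [NormedAlgebra ℝ A]

/-- At directions commuting with the base point, the differential of a polynomial map of a
Banach algebra is multiplication by the value of the derivative. -/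
theorem exists_hasFDerivAt_aeval (f : ℝ[X]) (a : A) :
    ∃ L : A →L[ℝ] A, HasFDerivAt (fun x : A => aeval x f) L a ∧
      ∀ c, Commute a c → L c = aeval a (derivative f) * c := by
  induction f using Polynomial.induction_on' with
  | add p q hp hq =>
    obtain ⟨L, hL, hLc⟩ := hp
    obtain ⟨L', hL', hLc'⟩ := hq
    refine ⟨L + L', by simpa using! hL.add hL', fun c hc => ?_⟩
    simp [hLc c hc, hLc' c hc, add_mul]
  | monomial n r =>
    induction n generalizing r with
    | zero =>
      refine ⟨0, ?_, fun c _ => by simp⟩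
      simpa using hasFDerivAt_const (𝕜 := ℝ) (algebraMap ℝ A r) a
    | succ n ih =>
      obtain ⟨L, hL, hLc⟩ := ih r
      -- Product rule for `x ^ (n + 1) = x ^ n * x`; commutation with `c` lets the two resulting
      -- terms be collected into the derivative times `c`.
      have hmul := hL.mul' (hasFDerivAt_id a)
      refine ⟨_, hmul.congr_of_eventuallyEq (.of_forall fun x => ?_), fun c hc => ?_⟩
      · simp [aeval_monomial, pow_succ, mul_assoc]
      · have h := hLc c hc
        have hd : derivative (monomial (n + 1) r) =
            monomial n r + derivative (monomial n r) * X := by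
          rw [← monomial_mul_X, derivative_mul, derivative_X, mul_one, add_comm]
        rw [hd]
        simp [h, add_mul, mul_assoc, hc.eq]

theorem contDiff_aeval (f : ℝ[X]) {n : WithTop ℕ∞} : ContDiff ℝ n fun x : A => aeval x f := by
  induction f using Polynomial.induction_on' with
  | add p q hp hq => simpa using hp.add hq
  | monomial n r =>
    simp only [aeval_monomial]
    exact contDiff_const.mul (contDiff_id.pow n)

/-- The Bézout relation `u * f + v * f' = 1`, evaluated at a root `a` of `f`, makes `v(a)` an
inverse of `f'(a)`; it is two-sided because polynomials in `a` commute. -/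
theorem isUnit_aeval_derivative {A : Type*} [Ring A] [Algebra ℝ A] {f : ℝ[X]}
    (hf : f.Separable) {a : A} (ha : aeval a f = 0) :
    IsUnit (aeval a (derivative f)) := by
  obtain ⟨u, v, huv⟩ := hf
  have h := congrArg (aeval a) huv
  simp only [map_add, map_mul, ha, mul_zero, zero_add, map_one] at h
  refine ⟨⟨_, aeval a v, ?_, h⟩, rfl⟩
  rw [← map_mul, mul_comm, map_mul, h]

theorem aeval_units_conj {A : Type*} [Ring A] [Algebra ℝ A] (f : ℝ[X]) (u : Aˣ) (a : A) :
    aeval ((u : A) * a * (↑u⁻¹ : A)) f = u * aeval a f * (↑u⁻¹ : A) := by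
  induction f using Polynomial.induction_on' with
  | add p q hp hq => simp [hp, hq, mul_add, add_mul]
  | monomial n r =>
    simp only [aeval_monomial, Units.conj_pow, ← mul_assoc, Algebra.commutes r (u : A)]

end Poly

/-! ### Exactness by counting dimensions. -/

/-- A complex `E → E' → W` with `dim E' ≤ dim E` is exact at `E'` if some linear map `J` makes
`L ∘ J` injective on the kernel of `D`. -/
theorem LinearMap.ker_eq_range_of_injOn_ker {E E' W : Type*} [AddCommGroup E] [Module ℝ E]
    [AddCommGroup E'] [Module ℝ E'] [AddCommGroup W] [Module ℝ W]
    [FiniteDimensional ℝ E] [FiniteDimensional ℝ E']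
    (hdim : Module.finrank ℝ E' ≤ Module.finrank ℝ E)
    {D : E →ₗ[ℝ] E'} {L : E' →ₗ[ℝ] W} {J : E →ₗ[ℝ] E'} (hLD : L ∘ₗ D = 0)
    (hJ : ∀ y, D y = 0 → L (J y) = 0 → y = 0) : LinearMap.ker L = LinearMap.range D := by
  symm
  refine Submodule.eq_of_le_of_finrank_le (LinearMap.range_le_ker_iff.2 hLD) ?_
  have h1 := LinearMap.finrank_range_add_finrank_ker D
  have h2 := LinearMap.finrank_range_add_finrank_ker L
  have h3 : Module.finrank ℝ (LinearMap.ker D) ≤ Module.finrank ℝ (LinearMap.range L) := by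
    refine LinearMap.finrank_le_finrank_of_injective
      (f := (L.rangeRestrict ∘ₗ J).domRestrict (LinearMap.ker D)) ?_
    rw [← LinearMap.ker_eq_bot, LinearMap.ker_eq_bot']
    rintro ⟨y, hy⟩ h
    exact Subtype.ext (hJ y hy (congrArg Subtype.val h))
  -- `dim ker L = dim E' - rank L ≤ dim E - dim ker D = rank D`.
  omega

/-! ### Slice charts along orbits. -/

section Slice

/-- The base point is allowed to match only propositionally, as for `g * 1` and `g`. -/
theorem HasMFDerivAt.comp_of_eq {E₁ E₂ E₃ M₁ M₂ M₃ : Type*}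
    [NormedAddCommGroup E₁] [NormedSpace ℝ E₁] [TopologicalSpace M₁] [ChartedSpace E₁ M₁]
    [NormedAddCommGroup E₂] [NormedSpace ℝ E₂] [TopologicalSpace M₂] [ChartedSpace E₂ M₂]
    [NormedAddCommGroup E₃] [NormedSpace ℝ E₃] [TopologicalSpace M₃] [ChartedSpace E₃ M₃]
    {g : M₂ → M₃} {f : M₁ → M₂} {x : M₁} {y : M₂} {g' : E₂ →L[ℝ] E₃} {f' : E₁ →L[ℝ] E₂}
    (hg : HasMFDerivAt 𝓘(ℝ, E₂) 𝓘(ℝ, E₃) g y g') (hf : HasMFDerivAt 𝓘(ℝ, E₁) 𝓘(ℝ, E₂) f x f')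
    (h : f x = y) : HasMFDerivAt 𝓘(ℝ, E₁) 𝓘(ℝ, E₃) (fun z => g (f z)) x (g' ∘L f') := by
  subst h
  exact hg.comp x hf

/-- The chain rule for a function of two variables, in terms of partial differentials. -/
theorem HasMFDerivAt.comp₂_of_eq {E₁ E₂ E₃ E₄ M₁ M₂ M₃ M₄ : Type*}
    [NormedAddCommGroup E₁] [NormedSpace ℝ E₁] [TopologicalSpace M₁] [ChartedSpace E₁ M₁]
    [NormedAddCommGroup E₂] [NormedSpace ℝ E₂] [TopologicalSpace M₂] [ChartedSpace E₂ M₂]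
    [NormedAddCommGroup E₃] [NormedSpace ℝ E₃] [TopologicalSpace M₃] [ChartedSpace E₃ M₃]
    [NormedAddCommGroup E₄] [NormedSpace ℝ E₄] [TopologicalSpace M₄] [ChartedSpace E₄ M₄]
    {f : M₂ → M₃ → M₄} {u : M₁ → M₂} {v : M₁ → M₃} {z : M₁} {x : M₂} {y : M₃}
    {f₁ : E₂ →L[ℝ] E₄} {f₂ : E₃ →L[ℝ] E₄} {u' : E₁ →L[ℝ] E₂} {v' : E₁ →L[ℝ] E₃}
    (hf : MDifferentiableAt (𝓘(ℝ, E₂).prod 𝓘(ℝ, E₃)) 𝓘(ℝ, E₄)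
      (fun q : M₂ × M₃ => f q.1 q.2) (x, y))
    (hf₁ : HasMFDerivAt 𝓘(ℝ, E₂) 𝓘(ℝ, E₄) (fun q => f q y) x f₁)
    (hf₂ : HasMFDerivAt 𝓘(ℝ, E₃) 𝓘(ℝ, E₄) (fun q => f x q) y f₂)
    (hu : HasMFDerivAt 𝓘(ℝ, E₁) 𝓘(ℝ, E₂) u z u') (hv : HasMFDerivAt 𝓘(ℝ, E₁) 𝓘(ℝ, E₃) v z v')
    (hx : u z = x) (hy : v z = y) :
    HasMFDerivAt 𝓘(ℝ, E₁) 𝓘(ℝ, E₄) (fun w => f (u w) (v w)) z (f₁ ∘L u' + f₂ ∘L v') := by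
  subst hx hy
  refine (hf.hasMFDerivAt.comp z (hu.prodMk hv)).congr_mfderiv ?_
  ext w
  refine (mfderiv_prod_eq_add_apply hf).trans ?_
  rw [hf₁.mfderiv, hf₂.mfderiv]
  rfl

/-- An injective linear map on a finite-dimensional space is bounded below, so near `a` the value
`c` can be taken only at `a` itself. -/
theorem HasFDerivAt.eventually_eq_of_injective {E F : Type*} [NormedAddCommGroup E]
    [NormedSpace ℝ E] [FiniteDimensional ℝ E] [NormedAddCommGroup F] [NormedSpace ℝ F]
    {g : E → F} {L : E →L[ℝ] F} {a : E} (c : F) (hg : HasFDerivAt g L a)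
    (hL : Function.Injective L) : ∀ᶠ w in 𝓝 a, g w = c → w = a := by
  obtain ⟨K, -, hK⟩ := (L : E →ₗ[ℝ] F).exists_antilipschitzWith (LinearMap.ker_eq_bot.2 hL)
  have h := hg.eventually_ne (c := c) ⟨K, hK⟩
  rw [eventually_nhdsWithin_iff] at h
  filter_upwards [h] with w hw hgw
  by_contra hne
  exact hw hne hgw

variable {E : Type*} [NormedAddCommGroup E] [NormedSpace ℝ E] [FiniteDimensional ℝ E]
  {G : Type*} [TopologicalSpace G] [ChartedSpace E G] [Group G] [IsManifold 𝓘(ℝ, E) ∞ G]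
  {E' : Type*} [NormedAddCommGroup E'] [NormedSpace ℝ E'] [FiniteDimensional ℝ E']
  {M : Type*} [TopologicalSpace M] [ChartedSpace E' M] [IsManifold 𝓘(ℝ, E') ∞ M]
  {W : Type*} [NormedAddCommGroup W] [NormedSpace ℝ W]

/-- Let `S` be the zero set of a smooth map `F` which is invariant under a smooth action of `G`.
At a point where the kernel of the differential of `F` is tangent to the orbit, there is a chart
in which `S` is a slice, and which only meets `S` in the orbit of that point. -/
theorem exists_slice_chart {a : G → M → M}
    (ha : ContMDiff (𝓘(ℝ, E).prod 𝓘(ℝ, E')) 𝓘(ℝ, E') ∞ fun q : G × M => a q.1 q.2)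
    (ha1 : ∀ x, a 1 x = x) {F : M → W} (hinv : ∀ g x, F (a g x) = 0 ↔ F x = 0)
    {p : M} (hp : F p = 0) {D : E →L[ℝ] E'} {L : E' →L[ℝ] W}
    (hD : HasMFDerivAt 𝓘(ℝ, E) 𝓘(ℝ, E') (fun g => a g p) 1 D)
    (hL : HasMFDerivAt 𝓘(ℝ, E') 𝓘(ℝ, W) F p L)
    (hexact : ∀ v, L v = 0 → v ∈ LinearMap.range (D : E →ₗ[ℝ] E')) :
    ∃ φ ∈ IsManifold.maximalAtlas 𝓘(ℝ, E') ∞ M, p ∈ φ.source ∧ ∃ T : Submodule ℝ E',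
      ∀ x ∈ φ.source, (F x = 0 ↔ φ x - φ p ∈ T) ∧ (F x = 0 → x ∈ range fun g => a g p) := by
  set T := LinearMap.range (D : E →ₗ[ℝ] E') with hT
  obtain ⟨K, hK⟩ := T.exists_isCompl
  obtain ⟨τ, hτ⟩ := (D : E →ₗ[ℝ] E').rangeRestrict.exists_rightInverse_of_surjective
    (LinearMap.range_rangeRestrict _)
  let κ : E' →L[ℝ] K := LinearMap.toContinuousLinearMap (K.projectionOnto T hK.symm)
  let σ : E' →L[ℝ] E := LinearMap.toContinuousLinearMap (τ ∘ₗ T.projectionOnto K hK)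
  have hσκ : ∀ w, D (σ w) + κ w = w := by
    intro w
    have h1 : D (σ w) = T.projectionOnto K hK w :=
      congrArg Subtype.val (LinearMap.congr_fun hτ (T.projectionOnto K hK w))
    rw [h1]
    exact Submodule.projection_add_projection_eq_self hK w
  have hκ0 : ∀ w, κ w = 0 ↔ w ∈ T := fun w => Submodule.projectionOnto_apply_eq_zero_iff hK.symm
  obtain ⟨m, hm0, hm, hm'⟩ := exists_local_parametrization (E := E) (1 : G)
  obtain ⟨s, hs0, hs, hs'⟩ := exists_local_parametrization (E := E') p
  -- Move transversally to the orbit by the `K`-component, then along the group by a lift of the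
  -- `T`-component. Invariance makes the vanishing of `F (Ψ w)` depend on `κ w` alone.
  let Ψ : E' → M := fun w => a (m (σ w)) (s (κ w))
  have hΨ0 : Ψ 0 = p := by simp [Ψ, hm0, hs0, ha1]
  have hFs : HasFDerivAt (fun k : K => F (s k)) (L ∘L K.subtypeL) 0 :=
    ((hL.comp_of_eq hs' hs0).comp_of_eq (f := fun k : K => (k : E'))
      K.subtypeL.hasFDerivAt.hasMFDerivAt rfl).hasFDerivAt
  have hker : Function.Injective (L ∘L K.subtypeL) := by
    refine (injective_iff_map_eq_zero _).2 fun k hk => ?_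
    exact Subtype.ext ((Submodule.disjoint_def.1 hK.disjoint) k (hexact _ hk) k.2)
  -- `L` is injective on the complement `K` of its kernel's bound `T`, so the transversal meets the
  -- zero set only at `p` near `p`.
  have hev : ∀ᶠ w in 𝓝 (0 : E'), F (s (κ w)) = 0 → κ w = 0 :=
    (κ.continuous.tendsto' 0 0 (map_zero _)).eventually
      (hFs.eventually_eq_of_injective 0 hker)
  have hmσ : ∀ᶠ w in 𝓝 (0 : E'), ContMDiffAt 𝓘(ℝ, E) 𝓘(ℝ, E) ∞ m (σ w) :=
    (σ.continuous.tendsto' 0 0 (map_zero _)).eventually hm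
  have hsκ : ∀ᶠ w in 𝓝 (0 : E'), ContMDiffAt 𝓘(ℝ, E') 𝓘(ℝ, E') ∞ s (K.subtypeL (κ w)) :=
    ((K.subtypeL ∘L κ).continuous.tendsto' 0 0 (map_zero _)).eventually hs
  have hΨs : ∀ᶠ w in 𝓝 (0 : E'), ContMDiffAt 𝓘(ℝ, E') 𝓘(ℝ, E') ∞ Ψ w := by
    filter_upwards [hmσ, hsκ] with w h1 h2
    exact ha.contMDiffAt.comp w ((h1.comp w σ.contDiff.contMDiff.contMDiffAt).prodMk
      (h2.comp w (K.subtypeL ∘L κ).contDiff.contMDiff.contMDiffAt))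
  have hΨ' : HasMFDerivAt 𝓘(ℝ, E') 𝓘(ℝ, E') Ψ 0 (ContinuousLinearMap.id ℝ E') := by
    have hu := hm'.comp_of_eq σ.hasFDerivAt.hasMFDerivAt (map_zero σ)
    have hv := hs'.comp_of_eq (K.subtypeL ∘L κ).hasFDerivAt.hasMFDerivAt
      (map_zero (K.subtypeL ∘L κ))
    have hid : HasMFDerivAt 𝓘(ℝ, E') 𝓘(ℝ, E') (fun x => a 1 x) p (ContinuousLinearMap.id ℝ E') := by
      exact (hasMFDerivAt_id p).congr_of_eventuallyEq (.of_forall ha1)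
    have h := HasMFDerivAt.comp₂_of_eq (f := a) (ha.contMDiffAt.mdifferentiableAt (by simp)) hD hid
      hu hv (by simp [hm0]) (by simp [hs0])
    refine h.congr_mfderiv ?_
    ext w
    exact hσκ w
  obtain ⟨φ, hφ, h0, hφU, hφΨ⟩ := exists_chart_of_injective_mfderiv (hΨs.and hev)
    (fun w hw => hw.1) (by rw [hΨ'.mfderiv]; exact Function.injective_id)
  have hsymm0 : φ.symm 0 = p := (hφΨ 0 h0).trans hΨ0
  have hφp : φ p = 0 := by rw [← hsymm0, φ.right_inv h0]
  refine ⟨φ, hφ, hsymm0 ▸ φ.map_target h0, T, fun x hx => ?_⟩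
  have hw := φ.map_source hx
  have hxΨ : x = a (m (σ (φ x))) (s (κ (φ x))) := (φ.left_inv hx).symm.trans (hφΨ _ hw)
  have h1 : F x = 0 → κ (φ x) = 0 := fun h => by
    rw [hxΨ, hinv] at h
    exact (hφU hw).2 h
  refine ⟨⟨fun h => ?_, fun h => ?_⟩, fun h => ⟨m (σ (φ x)), ?_⟩⟩
  · rw [hφp, sub_zero]
    exact (hκ0 _).1 (h1 h)
  · rw [hφp, sub_zero, ← hκ0] at h
    rw [hxΨ, hinv, h]
    simpa [hs0] using hp
  · conv_rhs => rw [hxΨ, h1 h]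
    simp [hs0]

end Slice

/-! ### From slices to components. -/

section Orbits

/-- Charts of the maximal atlas can be transported by a diffeomorphism. -/
theorem Homeomorph.transOpenPartialHomeomorph_mem_maximalAtlas
    {E' : Type*} [NormedAddCommGroup E'] [NormedSpace ℝ E'] {M : Type*} [TopologicalSpace M]
    [ChartedSpace E' M] [IsManifold 𝓘(ℝ, E') ∞ M] (e : M ≃ₜ M)
    (he : ContMDiff 𝓘(ℝ, E') 𝓘(ℝ, E') ∞ e) (he' : ContMDiff 𝓘(ℝ, E') 𝓘(ℝ, E') ∞ e.symm)
    {φ : OpenPartialHomeomorph M E'} (hφ : φ ∈ IsManifold.maximalAtlas 𝓘(ℝ, E') ∞ M) :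
    e.transOpenPartialHomeomorph φ ∈ IsManifold.maximalAtlas 𝓘(ℝ, E') ∞ M := by
  apply OpenPartialHomeomorph.mem_maximalAtlas_of_contMDiffOn
  · exact (contMDiffOn_of_mem_maximalAtlas hφ).comp he.contMDiffOn fun x hx => hx
  · exact he'.comp_contMDiffOn (contMDiffOn_symm_of_mem_maximalAtlas hφ)

variable {E : Type*} [NormedAddCommGroup E] [NormedSpace ℝ E] [FiniteDimensional ℝ E]
  {G : Type*} [TopologicalSpace G] [ChartedSpace E G] [Group G] [IsManifold 𝓘(ℝ, E) ∞ G]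
  {E' : Type*} [NormedAddCommGroup E'] [NormedSpace ℝ E'] [FiniteDimensional ℝ E']
  {M : Type*} [TopologicalSpace M] [ChartedSpace E' M] [IsManifold 𝓘(ℝ, E') ∞ M]
  {W : Type*} [NormedAddCommGroup W] [NormedSpace ℝ W]

/-- If a connected Lie group acts smoothly and the zero set of an invariant map `F` is
infinitesimally an orbit at each of its points, then the connected components of this zero set are
orbits and closed embedded submanifolds. -/
theorem connectedComponentIn_zeroSet_eq_orbit [ConnectedSpace G] {a : G → M → M}
    (ha : ContMDiff (𝓘(ℝ, E).prod 𝓘(ℝ, E')) 𝓘(ℝ, E') ∞ fun q : G × M => a q.1 q.2)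
    (ha1 : ∀ x, a 1 x = x) (hamul : ∀ g h x, a (g * h) x = a g (a h x))
    {F : M → W} (hF : Continuous F) (hinv : ∀ g x, F x = 0 → F (a g x) = 0)
    (hinf : ∀ p, F p = 0 → ∃ (D : E →L[ℝ] E') (L : E' →L[ℝ] W),
      HasMFDerivAt 𝓘(ℝ, E) 𝓘(ℝ, E') (fun g => a g p) 1 D ∧
      HasMFDerivAt 𝓘(ℝ, E') 𝓘(ℝ, W) F p L ∧
      ∀ v, L v = 0 → v ∈ LinearMap.range (D : E →ₗ[ℝ] E'))
    {p : M} (hp : F p = 0) :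
    IsClosedEmbeddedSubmanifold E' (connectedComponentIn {x | F x = 0} p) ∧
      connectedComponentIn {x | F x = 0} p = range fun g => a g p := by
  have hcancel : ∀ g x, a g⁻¹ (a g x) = x := fun g x => by rw [← hamul, inv_mul_cancel, ha1]
  have hcancel' : ∀ g x, a g (a g⁻¹ x) = x := fun g x => by rw [← hamul, mul_inv_cancel, ha1]
  have hinv' : ∀ g x, F (a g x) = 0 ↔ F x = 0 := fun g x =>
    ⟨fun h => by simpa [hcancel] using hinv g⁻¹ _ h, hinv g x⟩
  have hslice : ∀ q, F q = 0 → ∃ φ ∈ IsManifold.maximalAtlas 𝓘(ℝ, E') ∞ M, q ∈ φ.source ∧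
      ∃ T : Submodule ℝ E', ∀ x ∈ φ.source, (F x = 0 ↔ φ x - φ q ∈ T) ∧
        (F x = 0 → x ∈ range fun g => a g q) := by
    intro q hq
    obtain ⟨D, L, hD, hL, hDL⟩ := hinf q hq
    exact exists_slice_chart ha ha1 hinv' hq hD hL hDL
  have htrans : ∀ {x y z : M}, x ∈ (range fun g => a g y) → x ∈ (range fun g => a g z) →
      y ∈ range fun g => a g z := by
    rintro x y z ⟨g, rfl⟩ ⟨h, hh : a h z = a g y⟩
    exact ⟨g⁻¹ * h, by simp [hamul, hh, hcancel]⟩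
  have horbS : ∀ {q}, F q = 0 → (range fun g => a g q) ⊆ {x | F x = 0} := by
    rintro q hq _ ⟨g, rfl⟩
    exact hinv g q hq
  have hself : ∀ q, q ∈ range fun g => a g q := fun q => ⟨1, ha1 q⟩
  -- Near a zero outside the orbit all zeros lie in another orbit; near a nonzero there are no zeros
  -- at all.
  have hclosed : IsClosed (range fun g => a g p) := by
    rw [← isOpen_compl_iff, isOpen_iff_mem_nhds]
    intro x hx
    by_cases hFx : F x = 0
    · obtain ⟨φ, -, hxφ, T, hT⟩ := hslice x hFx
      filter_upwards [φ.open_source.mem_nhds hxφ] with y hy hyp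
      exact hx (htrans ((hT y hy).2 (horbS hp hyp)) hyp)
    · filter_upwards [(isOpen_compl_singleton.preimage hF).mem_nhds hFx] with y hy hyp
      exact hy (horbS hp hyp)
  have hcont : Continuous fun g => a g p :=
    ha.continuous.comp (continuous_id.prodMk continuous_const)
  have hcc : connectedComponentIn {x | F x = 0} p = range fun g => a g p := by
    apply Subset.antisymm
    · have hopen : ∃ O : Set M, IsOpen O ∧ (range fun g => a g p) ⊆ O ∧
          O ∩ {x | F x = 0} ⊆ range fun g => a g p := by
        refine ⟨interior {x | F x = 0 → x ∈ range fun g => a g p}, isOpen_interior, ?_,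
          fun x hx => interior_subset hx.1 hx.2⟩
        intro q hq
        obtain ⟨φ, -, hqφ, T, hT⟩ := hslice q (horbS hp hq)
        refine mem_interior_iff_mem_nhds.2 ?_
        filter_upwards [φ.open_source.mem_nhds hqφ] with y hy hFy
        exact htrans (x := q) (by
          obtain ⟨g, hg⟩ := (hT y hy).2 hFy
          exact ⟨g⁻¹, by simp [← hg, hcancel]⟩) hq
      obtain ⟨O, hO, hpO, hOS⟩ := hopen
      have hsub := connectedComponentIn_subset {x | F x = 0} p
      -- `O` and the complement of the orbit are open, cover the component and are disjoint on it,
      -- so the component lies in one of them.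
      rcases isPreconnected_iff_subset_of_disjoint.1
        (isPreconnected_connectedComponentIn (F := {x | F x = 0}) (x := p)) O
        (range fun g => a g p)ᶜ hO hclosed.isOpen_compl
        (fun x _ => (em (x ∈ range fun g => a g p)).imp (fun h => hpO h) id)
        (eq_empty_of_forall_notMem fun x hx => hx.2.2 (hOS ⟨hx.2.1, hsub hx.1⟩)) with h | h
      · exact fun x hx => hOS ⟨h hx, hsub hx⟩
      · exact absurd (hself p) (h (mem_connectedComponentIn hp))
    · exact (isPreconnected_range hcont).subset_connectedComponentIn (hself p) (horbS hp)
  refine ⟨?_, hcc⟩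
  rw [hcc]
  refine ⟨hclosed, ?_⟩
  -- Translates of this single chart serve all points of the orbit, which makes the dimension
  -- constant.
  obtain ⟨φ, hφ, hpφ, T, hT⟩ := hslice p hp
  refine ⟨Module.finrank ℝ T, ?_⟩
  rintro _ ⟨g, rfl⟩
  have hsm : ∀ g, ContMDiff 𝓘(ℝ, E') 𝓘(ℝ, E') ∞ (a g) := fun g =>
    ha.comp (contMDiff_const.prodMk contMDiff_id)
  let e : M ≃ₜ M :=
    { toFun := a g⁻¹
      invFun := a g
      left_inv := hcancel' g
      right_inv := hcancel g
      continuous_toFun := (hsm _).continuous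
      continuous_invFun := (hsm _).continuous }
  refine ⟨e.transOpenPartialHomeomorph φ,
    e.transOpenPartialHomeomorph_mem_maximalAtlas (hsm _) (hsm _) hφ, ?_, T, rfl, fun x hx => ?_⟩
  · change a g⁻¹ (a g p) ∈ φ.source
    rwa [hcancel]
  · have hx' : a g⁻¹ x ∈ φ.source := hx
    change x ∈ range _ ↔ φ (a g⁻¹ x) - φ (a g⁻¹ (a g p)) ∈ T
    rw [hcancel, ← (hT _ hx').1]
    refine ⟨fun h => hinv _ _ (horbS hp h), fun h => ?_⟩
    obtain ⟨k, hk : a k p = a g⁻¹ x⟩ := (hT _ hx').2 h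
    exact ⟨g * k, by simp [hamul, hk, hcancel']⟩

end Orbits

/-! ### Differentials of representations. -/

section Representations

variable {E : Type*} [NormedAddCommGroup E] [NormedSpace ℝ E]
  {G : Type*} [TopologicalSpace G] [ChartedSpace E G] [Group G]
  {V : Type*} [NormedAddCommGroup V] [NormedSpace ℝ V] {ρ : G →* (V →L[ℝ] V)ˣ}

theorem hasMFDerivAt_representationDifferential
    (hρ : ContMDiff 𝓘(ℝ, E) 𝓘(ℝ, V →L[ℝ] V) ∞ (fun g : G => (ρ g : V →L[ℝ] V))) :
    HasMFDerivAt 𝓘(ℝ, E) 𝓘(ℝ, V →L[ℝ] V) (fun g : G => (ρ g : V →L[ℝ] V)) 1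
      (representationDifferential (E := E) ρ) :=
  (hρ.contMDiffAt.mdifferentiableAt (by simp)).hasMFDerivAt

/-- The differential of a representation at `g`, on a left-translated vector. -/
theorem mfderiv_representation_translate
    (hρ : ContMDiff 𝓘(ℝ, E) 𝓘(ℝ, V →L[ℝ] V) ∞ (fun g : G => (ρ g : V →L[ℝ] V)))
    {g : G} {L : E →L[ℝ] V →L[ℝ] V} {J : E →L[ℝ] E}
    (hL : HasMFDerivAt 𝓘(ℝ, E) 𝓘(ℝ, V →L[ℝ] V) (fun g : G => (ρ g : V →L[ℝ] V)) g L)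
    (hJ : HasMFDerivAt 𝓘(ℝ, E) 𝓘(ℝ, E) (fun x : G => g * x) 1 J) (Y : E) :
    L (J Y) = (ρ g : V →L[ℝ] V) * representationDifferential (E := E) ρ Y := by
  have h1 := hL.comp_of_eq hJ (mul_one g)
  have h2 : HasMFDerivAt 𝓘(ℝ, E) 𝓘(ℝ, V →L[ℝ] V)
      (fun x : G => (ρ g : V →L[ℝ] V) * (ρ x : V →L[ℝ] V)) 1
      (ContinuousLinearMap.mul ℝ (V →L[ℝ] V) (ρ g : V →L[ℝ] V) ∘L
        (representationDifferential (E := E) ρ : E →L[ℝ] V →L[ℝ] V)) :=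
    HasMFDerivAt.comp_of_eq (g := fun B => (ρ g : V →L[ℝ] V) * B)
      (ContinuousLinearMap.mul ℝ (V →L[ℝ] V) (ρ g : V →L[ℝ] V)).hasFDerivAt.hasMFDerivAt
      (hasMFDerivAt_representationDifferential hρ) rfl
  have h3 : (fun x : G => (ρ (g * x) : V →L[ℝ] V)) =
      fun x : G => (ρ g : V →L[ℝ] V) * (ρ x : V →L[ℝ] V) := by
    ext1 x
    rw [map_mul, Units.val_mul]
  rw [h3] at h1
  exact congrArg (fun T : E →L[ℝ] V →L[ℝ] V => T Y) (hasMFDerivAt_unique h1 h2)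

/-- The differential at the identity of the orbit map `h ↦ ρ h * A * ρ h⁻¹`. -/
theorem mfderiv_conj_representation
    (hρ : ContMDiff 𝓘(ℝ, E) 𝓘(ℝ, V →L[ℝ] V) ∞ (fun g : G => (ρ g : V →L[ℝ] V)))
    {A : V →L[ℝ] V} {R : G → V →L[ℝ] V} (hR : ∀ h, R h = ρ h * A * (↑(ρ h)⁻¹ : V →L[ℝ] V))
    {R' : E →L[ℝ] V →L[ℝ] V} (hR' : HasMFDerivAt 𝓘(ℝ, E) 𝓘(ℝ, V →L[ℝ] V) R 1 R') (Y : E) :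
    R' Y + A * representationDifferential (E := E) ρ Y =
      representationDifferential (E := E) ρ Y * A := by
  have hd := hasMFDerivAt_representationDifferential hρ
  -- Differentiating `R h * ρ h = ρ h * A` avoids differentiating the inverse.
  have h1 := hR'.mul' hd
  have h2 := hd.mul' (hasMFDerivAt_const (I := 𝓘(ℝ, E)) (I' := 𝓘(ℝ, V →L[ℝ] V)) A (1 : G))
  have h3 : (R * fun g : G => (ρ g : V →L[ℝ] V)) =
      (fun g : G => (ρ g : V →L[ℝ] V)) * fun _ => A := by
    ext1 h
    simp [hR, mul_assoc]
  rw [h3] at h1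
  have h4 := congrArg (fun T : E →L[ℝ] V →L[ℝ] V => T Y) (hasMFDerivAt_unique h1 h2)
  have hR1 : R 1 = A := by simp [hR]
  simp only [hR1] at h4
  have h5 : A * representationDifferential (E := E) ρ Y + R' Y * (ρ 1 : V →L[ℝ] V) =
    (ρ 1 : V →L[ℝ] V) * 0 + representationDifferential (E := E) ρ Y * A := h4
  simpa [add_comm] using h5

/-- A representation with discrete kernel is infinitesimally faithful. -/
theorem representationDifferential_injective [FiniteDimensional ℝ E] [LieGroup 𝓘(ℝ, E) ∞ G]
    (hρ : ContMDiff 𝓘(ℝ, E) 𝓘(ℝ, V →L[ℝ] V) ∞ (fun g : G => (ρ g : V →L[ℝ] V)))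
    (hker : DiscreteTopology ρ.ker) :
    Function.Injective (representationDifferential (E := E) ρ) := by
  have : CompleteSpace E := FiniteDimensional.complete ℝ E
  have : LieGroup 𝓘(ℝ, E) (minSmoothness ℝ 3) G :=
    LieGroup.of_le (n := ∞) (by
      rw [minSmoothness_of_isRCLikeNormedField]
      exact WithTop.coe_le_coe.2 (le_top (a := (3 : ℕ∞))))
  refine (injective_iff_map_eq_zero _).2 fun Y hY => ?_
  -- Follow the integral curve through `1` of the invariant field of `Y`. As `dρ Y = 0`, `ρ` is
  -- constant along it, so it stays in the discrete kernel, is locally constant, and has velocity `Y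
  -- = 0` at time `0`.
  have hv := contMDiffAt_mulInvariantVectorField (I := 𝓘(ℝ, E)) (G := G) Y (g := 1)
  obtain ⟨γ, hγ0, hγ⟩ := exists_isMIntegralCurveAt_of_contMDiffAt_boundaryless (t₀ := 0)
    (hv.of_le (by simp))
  obtain ⟨ε, hε, hball⟩ := Metric.eventually_nhds_iff_ball.1 hγ
  have hderiv : ∀ t ∈ Metric.ball (0 : ℝ) ε,
      HasFDerivAt (fun t => (ρ (γ t) : V →L[ℝ] V)) (0 : ℝ →L[ℝ] V →L[ℝ] V) t := by
    intro t ht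
    have hL := (hρ.contMDiffAt (x := γ t)).mdifferentiableAt (by simp) |>.hasMFDerivAt
    have hJ : HasMFDerivAt 𝓘(ℝ, E) 𝓘(ℝ, E) (fun x : G => γ t * x) 1 _ :=
      ((contMDiff_mul_left (I := 𝓘(ℝ, E)) (n := ∞) (a := γ t)).contMDiffAt.mdifferentiableAt
        (by simp)).hasMFDerivAt
    have h0 := mfderiv_representation_translate hρ hL hJ Y
    rw [hY, mul_zero] at h0
    refine ((HasMFDerivAt.comp_of_eq hL (hball t ht) rfl).congr_mfderiv ?_).hasFDerivAt
    ext1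
    exact (one_smul ℝ _ |> congrArg _).trans h0
  have hconst : ∀ t ∈ Metric.ball (0 : ℝ) ε, γ t ∈ ρ.ker := by
    intro t ht
    have h := (convex_ball (0 : ℝ) ε).is_const_of_fderivWithin_eq_zero (𝕜 := ℝ)
      (fun s hs => (hderiv s hs).differentiableAt.differentiableWithinAt)
      (fun s hs => (hderiv s hs).hasFDerivWithinAt.fderivWithin
        (Metric.isOpen_ball.uniqueDiffWithinAt hs)) ht (Metric.mem_ball_self hε)
    rw [MonoidHom.mem_ker]
    exact Units.ext (by simpa [hγ0] using h)
  obtain ⟨U, hU, hU1⟩ : ∃ U ∈ 𝓝 (1 : G), ∀ x ∈ U, x ∈ ρ.ker → x = 1 := by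
    have h := (discreteTopology_iff_singleton_mem_nhds.1 hker) 1
    rw [nhds_subtype, mem_comap] at h
    obtain ⟨U, hU, hUs⟩ := h
    exact ⟨U, hU, fun x hx hxk => congrArg Subtype.val (hUs (a := ⟨x, hxk⟩) hx)⟩
  have hγc : ContinuousAt γ 0 := (hball 0 (Metric.mem_ball_self hε)).continuousAt
  have hγ1 : γ =ᶠ[𝓝 0] fun _ => 1 := by
    filter_upwards [Metric.ball_mem_nhds (0 : ℝ) hε,
      hγc.preimage_mem_nhds (by rwa [hγ0])] with t ht htU
    exact hU1 _ htU (hconst t ht)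
  have h0 := hball 0 (Metric.mem_ball_self hε)
  have h1 := (hasMFDerivAt_const (I := 𝓘(ℝ, ℝ)) (I' := 𝓘(ℝ, E)) (1 : G)
    (0 : ℝ)).congr_of_eventuallyEq hγ1
  have h2 := congrArg (fun T : ℝ →L[ℝ] E => T 1) (hasMFDerivAt_unique h0 h1)
  have h3 : (mulInvariantVectorField (I := 𝓘(ℝ, E)) Y (γ 0) : E) = 0 :=
    (one_smul ℝ (mulInvariantVectorField (I := 𝓘(ℝ, E)) Y (γ 0) : E)).symm.trans h2
  rw [hγ0] at h3
  have h4 : HasMFDerivAt 𝓘(ℝ, E) 𝓘(ℝ, E) (fun x : G => 1 * x) 1 (ContinuousLinearMap.id ℝ E) :=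
    (hasMFDerivAt_id (1 : G)).congr_of_eventuallyEq (.of_forall one_mul)
  have h5 : mulInvariantVectorField (I := 𝓘(ℝ, E)) Y (1 : G) = Y :=
    congrArg (fun T : E →L[ℝ] E => T Y) h4.mfderiv
  exact h5.symm.trans h3

end Representations

/-! ### The two zero sets. -/

section ZeroSets

variable {E : Type*} [NormedAddCommGroup E] [NormedSpace ℝ E]
  {G : Type*} [TopologicalSpace G] [ChartedSpace E G] [Group G]
  {V : Type*} [NormedAddCommGroup V] [NormedSpace ℝ V] {ρ : G →* (V →L[ℝ] V)ˣ}

theorem contMDiff_representation_inv [LieGroup 𝓘(ℝ, E) ∞ G]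
    (hρ : ContMDiff 𝓘(ℝ, E) 𝓘(ℝ, V →L[ℝ] V) ∞ (fun g : G => (ρ g : V →L[ℝ] V))) :
    ContMDiff 𝓘(ℝ, E) 𝓘(ℝ, V →L[ℝ] V) ∞ (fun g : G => (↑(ρ g)⁻¹ : V →L[ℝ] V)) := by
  simpa only [Function.comp_def, map_inv] using hρ.comp (contMDiff_inv 𝓘(ℝ, E) ∞)

/-- `dρ ∘ Ad h` is conjugation by `ρ h` composed with `dρ`. -/
theorem representationDifferential_lieAd [LieGroup 𝓘(ℝ, E) ∞ G]
    (hρ : ContMDiff 𝓘(ℝ, E) 𝓘(ℝ, V →L[ℝ] V) ∞ (fun g : G => (ρ g : V →L[ℝ] V)))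
    (h : G) (X : GroupLieAlgebra 𝓘(ℝ, E) G) :
    representationDifferential ρ (lieAd h X) =
      (ρ h : V →L[ℝ] V) * representationDifferential ρ X * (↑(ρ h)⁻¹ : V →L[ℝ] V) := by
  have hd := hasMFDerivAt_representationDifferential hρ
  have hconj : ContMDiff 𝓘(ℝ, E) 𝓘(ℝ, E) ∞ (fun x : G => h * x * h⁻¹) :=
    (contMDiff_const.mul contMDiff_id).mul contMDiff_const
  have hAd : HasMFDerivAt 𝓘(ℝ, E) 𝓘(ℝ, E) (fun x : G => h * x * h⁻¹) 1
      (lieAd h : GroupLieAlgebra 𝓘(ℝ, E) G →L[ℝ] GroupLieAlgebra 𝓘(ℝ, E) G) :=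
    (hconj.contMDiffAt.mdifferentiableAt (by simp)).hasMFDerivAt
  have h1 := hd.comp_of_eq hAd (by simp)
  let C : (V →L[ℝ] V) →L[ℝ] V →L[ℝ] V :=
    (ContinuousLinearMap.mul ℝ (V →L[ℝ] V)).flip (↑(ρ h)⁻¹ : V →L[ℝ] V) ∘L
      ContinuousLinearMap.mul ℝ (V →L[ℝ] V) (ρ h : V →L[ℝ] V)
  have h2 := HasMFDerivAt.comp_of_eq (g := C) C.hasFDerivAt.hasMFDerivAt hd rfl
  have h3 : (fun x : G => (ρ (h * x * h⁻¹) : V →L[ℝ] V)) =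
      fun x : G => C (ρ x : V →L[ℝ] V) := by
    ext1 x
    simp [C]
  rw [h3] at h1
  exact congrArg (fun T : E →L[ℝ] V →L[ℝ] V => T X) (hasMFDerivAt_unique h1 h2)

variable [FiniteDimensional ℝ E] [LieGroup 𝓘(ℝ, E) ∞ G] {f : Polynomial ℝ}

/-- The components of the zero set of a separable polynomial in `ρ` are conjugacy classes. -/
theorem connectedComponentIn_groupZeroSet [ConnectedSpace G]
    (hρ : ContMDiff 𝓘(ℝ, E) 𝓘(ℝ, V →L[ℝ] V) ∞ (fun g : G => (ρ g : V →L[ℝ] V)))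
    (hker : DiscreteTopology ρ.ker) (hf : f.Separable) {g : G} (hg : g ∈ groupZeroSet ρ f) :
    IsClosedEmbeddedSubmanifold E (connectedComponentIn (groupZeroSet ρ f) g) ∧
      connectedComponentIn (groupZeroSet ρ f) g = conjugatesOf g := by
  have hconjOf : conjugatesOf g = range fun h : G => h * g * h⁻¹ := by
    ext x
    exact isConj_iff
  have ha : ContMDiff (𝓘(ℝ, E).prod 𝓘(ℝ, E)) 𝓘(ℝ, E) ∞
      fun q : G × G => q.1 * q.2 * q.1⁻¹ :=
    (contMDiff_fst.mul contMDiff_snd).mul contMDiff_fst.inv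
  have hF : ContMDiff 𝓘(ℝ, E) 𝓘(ℝ, V →L[ℝ] V) ∞
      (fun x : G => Polynomial.aeval (ρ x : V →L[ℝ] V) f) :=
    (contDiff_aeval f).contMDiff.comp hρ
  have hinv : ∀ h x : G, Polynomial.aeval (ρ x : V →L[ℝ] V) f = 0 →
      Polynomial.aeval (ρ (h * x * h⁻¹) : V →L[ℝ] V) f = 0 := by
    intro h x hx
    rw [map_mul, map_mul, map_inv, Units.val_mul, Units.val_mul, aeval_units_conj, hx, mul_zero,
      zero_mul]
  rw [hconjOf]
  refine connectedComponentIn_zeroSet_eq_orbit (a := fun h x : G => h * x * h⁻¹) ha (by simp)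
    (fun h k x => by group) hF.continuous hinv (fun x hx => ?_) hg
  have hA : Polynomial.aeval (ρ x : V →L[ℝ] V) f = 0 := hx
  obtain ⟨Lf, hLf, hLfc⟩ := exists_hasFDerivAt_aeval f (ρ x : V →L[ℝ] V)
  obtain ⟨Lρ, hLρ⟩ : ∃ Lρ : E →L[ℝ] V →L[ℝ] V,
      HasMFDerivAt 𝓘(ℝ, E) 𝓘(ℝ, V →L[ℝ] V) (fun g : G => (ρ g : V →L[ℝ] V)) x Lρ :=
    ⟨_, (hρ.contMDiffAt.mdifferentiableAt (by simp)).hasMFDerivAt⟩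
  obtain ⟨J, hJ⟩ : ∃ J : E →L[ℝ] E, HasMFDerivAt 𝓘(ℝ, E) 𝓘(ℝ, E) (fun y : G => x * y) 1 J :=
    ⟨_, ((contMDiff_mul_left (I := 𝓘(ℝ, E)) (n := ∞) (a := x)).contMDiffAt.mdifferentiableAt
      (by simp)).hasMFDerivAt⟩
  obtain ⟨D, hD⟩ : ∃ D : E →L[ℝ] E,
      HasMFDerivAt 𝓘(ℝ, E) 𝓘(ℝ, E) (fun h : G => h * x * h⁻¹) 1 D :=
    ⟨_, (((contMDiff_id.mul contMDiff_const).mul (contMDiff_inv 𝓘(ℝ, E) ∞)).contMDiffAt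
      |>.mdifferentiableAt (by simp)).hasMFDerivAt⟩
  have hL := hLf.hasMFDerivAt.comp_of_eq hLρ rfl
  refine ⟨D, Lf ∘L Lρ, hD, hL, fun v hv => ?_⟩
  -- The map vanishes identically along the orbit.
  have hLD : (Lf ∘L Lρ) ∘L D = 0 := by
    refine hasMFDerivAt_unique (hL.comp_of_eq hD (by simp)) ?_
    exact (hasMFDerivAt_const (I := 𝓘(ℝ, E)) (I' := 𝓘(ℝ, V →L[ℝ] V)) (0 : V →L[ℝ] V)
      (1 : G)).congr_of_eventuallyEq (.of_forall fun h => hinv h x hx)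
  -- `D y = 0` means that `dρ y` commutes with `A = ρ x`; then `L (J y) = f'(A) * A * dρ y` with
  -- both left factors invertible.
  have hJD : ∀ y : E, D y = 0 → Lf (Lρ (J y)) = 0 → y = 0 := by
    intro y hy hLy
    have hcomm := mfderiv_conj_representation hρ (A := (ρ x : V →L[ℝ] V)) (R' := Lρ ∘L D)
      (fun h => by simp) (hLρ.comp_of_eq hD (by simp)) y
    rw [ContinuousLinearMap.comp_apply, hy, map_zero, zero_add] at hcomm
    have hc : Commute (ρ x : V →L[ℝ] V) (representationDifferential (E := E) ρ y) := hcomm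
    rw [mfderiv_representation_translate hρ hLρ hJ,
      hLfc _ ((Commute.refl _).mul_right hc),
      (isUnit_aeval_derivative hf hA).mul_right_eq_zero, (ρ x).isUnit.mul_right_eq_zero] at hLy
    exact representationDifferential_injective hρ hker (hLy.trans (map_zero _).symm)
  rw [← LinearMap.ker_eq_range_of_injOn_ker (L := (Lf ∘L Lρ : E →L[ℝ] V →L[ℝ] V).toLinearMap)
    (J := J.toLinearMap) le_rfl (congrArg ContinuousLinearMap.toLinearMap hLD) hJD]
  exact hv

/-- The components of the zero set of a separable polynomial in `dρ` are adjoint orbits. -/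
theorem connectedComponentIn_lieAlgebraZeroSet [FiniteDimensional ℝ V] [ConnectedSpace G]
    (hρ : ContMDiff 𝓘(ℝ, E) 𝓘(ℝ, V →L[ℝ] V) ∞ (fun g : G => (ρ g : V →L[ℝ] V)))
    (hker : DiscreteTopology ρ.ker) (hf : f.Separable) {X : GroupLieAlgebra 𝓘(ℝ, E) G}
    (hX : X ∈ lieAlgebraZeroSet (E := E) ρ f) :
    IsClosedEmbeddedSubmanifold E (connectedComponentIn (lieAlgebraZeroSet ρ f) X) ∧
      connectedComponentIn (lieAlgebraZeroSet ρ f) X = adjointOrbit X := by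
  let d : E →L[ℝ] V →L[ℝ] V := representationDifferential (E := E) ρ
  let Ad : G → E → E := fun h => lieAd (E := E) h
  have hdinj : Function.Injective d := representationDifferential_injective hρ hker
  have hdAd : ∀ h x, d (Ad h x) = (ρ h : V →L[ℝ] V) * d x * (↑(ρ h)⁻¹ : V →L[ℝ] V) :=
    representationDifferential_lieAd hρ
  -- A linear left inverse of `dρ` expresses `Ad h x` through conjugation by `ρ h`, which gives
  -- joint smoothness of the adjoint action.
  obtain ⟨r₀, hr₀⟩ := (d : E →ₗ[ℝ] V →L[ℝ] V).exists_leftInverse_of_injective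
    (LinearMap.ker_eq_bot.2 hdinj)
  let r : (V →L[ℝ] V) →L[ℝ] E := LinearMap.toContinuousLinearMap r₀
  have hrd : ∀ x, r (d x) = x := LinearMap.congr_fun hr₀
  have hAd : ∀ h x, Ad h x = r ((ρ h : V →L[ℝ] V) * d x * (↑(ρ h)⁻¹ : V →L[ℝ] V)) := fun h x => by
    rw [← hdAd, hrd]
  have ha : ContMDiff (𝓘(ℝ, E).prod 𝓘(ℝ, E)) 𝓘(ℝ, E) ∞ fun q : G × E => Ad q.1 q.2 := by
    simp only [hAd]
    exact r.contDiff.contMDiff.comp (((hρ.comp contMDiff_fst).clm_comp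
      (d.contDiff.contMDiff.comp contMDiff_snd)).clm_comp
      ((contMDiff_representation_inv hρ).comp contMDiff_fst))
  have hF : ContDiff ℝ ∞ (fun x : E => Polynomial.aeval (d x) f) :=
    (contDiff_aeval f).comp d.contDiff
  have hinv : ∀ (h : G) (x : E), Polynomial.aeval (d x) f = 0 →
      Polynomial.aeval (d (Ad h x)) f = 0 := by
    intro h x hx
    rw [hdAd, aeval_units_conj, hx, mul_zero, zero_mul]
  refine connectedComponentIn_zeroSet_eq_orbit (E' := E) (M := E) (a := Ad) ha
    (fun x => hdinj (by simp [hdAd])) (fun h k x => hdinj (by simp [hdAd, mul_assoc]))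
    hF.continuous hinv (fun x hx => ?_) hX
  obtain ⟨Lf, hLf, hLfc⟩ := exists_hasFDerivAt_aeval f (d x)
  obtain ⟨D, hD⟩ : ∃ D : E →L[ℝ] E, HasMFDerivAt 𝓘(ℝ, E) 𝓘(ℝ, E) (fun h : G => Ad h x) 1 D :=
    ⟨_, ((ha.comp (contMDiff_id.prodMk contMDiff_const)).contMDiffAt.mdifferentiableAt
      (by simp)).hasMFDerivAt⟩
  have hL : HasMFDerivAt 𝓘(ℝ, E) 𝓘(ℝ, V →L[ℝ] V) (fun x : E => Polynomial.aeval (d x) f) x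
      (Lf ∘L d) := (hLf.comp x d.hasFDerivAt).hasMFDerivAt
  have hAd1 : Ad 1 x = x := hdinj (by simp [hdAd])
  refine ⟨D, Lf ∘L d, hD, hL, fun v hv => ?_⟩
  have hLD : (Lf ∘L d) ∘L D = 0 := by
    refine hasMFDerivAt_unique (hL.comp_of_eq hD hAd1) ?_
    exact (hasMFDerivAt_const (I := 𝓘(ℝ, E)) (I' := 𝓘(ℝ, V →L[ℝ] V)) (0 : V →L[ℝ] V)
      (1 : G)).congr_of_eventuallyEq (.of_forall fun h => hinv h x hx)
  have hJD : ∀ y : E, D y = 0 → Lf (d y) = 0 → y = 0 := by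
    intro y hy hLy
    have hcomm := mfderiv_conj_representation hρ (A := d x) (R' := d ∘L D) (fun h => hdAd h x)
      (HasMFDerivAt.comp_of_eq (g := d) d.hasFDerivAt.hasMFDerivAt hD rfl) y
    rw [ContinuousLinearMap.comp_apply, hy, map_zero, zero_add] at hcomm
    have hc : Commute (d x) (d y) := hcomm
    rw [hLfc _ hc, (isUnit_aeval_derivative hf hx).mul_right_eq_zero] at hLy
    exact hdinj (hLy.trans (map_zero _).symm)
  -- Here the ambient manifold is the Lie algebra itself, so no translation is needed and `J` is the
  -- identity.
  rw [← LinearMap.ker_eq_range_of_injOn_ker (L := (Lf ∘L d : E →L[ℝ] V →L[ℝ] V).toLinearMap)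
    (J := LinearMap.id) le_rfl (congrArg ContinuousLinearMap.toLinearMap hLD) hJD]
  exact hv

end ZeroSets

theorem theoremT {E : Type*} [NormedAddCommGroup E] [NormedSpace ℝ E] [FiniteDimensional ℝ E]
    {G : Type*} [TopologicalSpace G] [ChartedSpace E G] [Group G] [LieGroup 𝓘(ℝ, E) ∞ G]
    [T2Space G] [ConnectedSpace G]
    {V : Type*} [NormedAddCommGroup V] [NormedSpace ℝ V] [FiniteDimensional ℝ V]
    (ρ : G →* (V →L[ℝ] V)ˣ)
    (hρ : ContMDiff 𝓘(ℝ, E) 𝓘(ℝ, V →L[ℝ] V) ∞ (fun g : G => (ρ g : V →L[ℝ] V)))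
    (hker : DiscreteTopology ρ.ker)
    (f : Polynomial ℝ) (hf0 : f ≠ 0) (hf : (f.aroots ℂ).Nodup) :
    (∀ g ∈ groupZeroSet ρ f,
      IsClosedEmbeddedSubmanifold E (connectedComponentIn (groupZeroSet ρ f) g) ∧
      connectedComponentIn (groupZeroSet ρ f) g = conjugatesOf g) ∧
    (∀ X ∈ lieAlgebraZeroSet (E := E) ρ f,
      IsClosedEmbeddedSubmanifold E (connectedComponentIn (lieAlgebraZeroSet ρ f) X) ∧
      connectedComponentIn (lieAlgebraZeroSet ρ f) X = adjointOrbit X) := by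
  have : (f.map (algebraMap ℝ ℂ)).Splits := IsAlgClosed.splits _
  -- `f ≠ 0` matters: the zero polynomial has an empty, hence duplicate-free, multiset of roots.
  have hsep : f.Separable := (Polynomial.nodup_aroots_iff_of_splits hf0 this).1 hf
  exact ⟨fun g hg => connectedComponentIn_groupZeroSet hρ hker hsep hg,
    fun X hX => connectedComponentIn_lieAlgebraZeroSet hρ hker hsep hX⟩
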